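/- A digraph here is a finite directed multigraph (multiple edges and loops allowed). A planar digraph is one with a fixed embedding into the sphere $S^2$; two connected planar digraphs are regarded as the same if an orientation-preserving homeomorphism of $S^2$ carries one to the other, respecting vertices, edges and directions (equivalently, if there is an isomorphism of digraphs that preserves the cyclic order of the edge ends around each vertex). A planar digraph $\mathcal{G}$ is prime if it contains no loop, it has no cut vertex (a vertex $v$ such that the subgraph induced on the vertices other than $v$ is disconnected), and there is no simple closed curve in $S^2$ that is disjoint from the vertices of $\mathcal{G}$, meets the edges of $\mathcal{G}$ at exactly two points, and has at least one vertex of $\mathcal{G}$ on each side. Let $\Gamma$ be the set of connected, planar, prime digraphs in which incoming and outgoing edges alternate in the cyclic order around every vertex. For a vertex $v$ of $\mathcal{G}$, let $\mathrm{Tr}(\mathcal{G},v)$ be the set of directed spanning subtrees of $\mathcal{G}$ with origin $v$, that is, of the subgraphs $\mathcal{T}$ containing all vertices of $\mathcal{G}$ that are connected, contain no simple closed curve, and in which every vertex is the terminal vertex of at most one edge of $\mathcal{T}$ and $v$ is the terminal vertex of none. **Theorem.** For every $n\in\mathbb{N}$ the set $$\Phi_n=\{\mathcal{G}\in\Gamma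 : \text{there is a vertex } v \text{ of } \mathcal{G} \text{ with } |\mathrm{Tr}(\mathcal{G},v)|\leq n\}$$ is finite. -/

import Mathlib

universe u

/-- A finite directed multigraph: multiple edges and loops are allowed. -/
structure FinDigraph where
  V : Type u
  E : Type u
  finV : Finite V
  finE : Finite E
  /-- initial endpoint of an edge -/
  init : E → V
  /-- terminal endpoint of an edge -/
  term : E → V

namespace FinDigraph

variable (G : FinDigraph.{u})

/-- The (undirected) graph of adjacencies of the subgraph with all the vertices of `G` and edge
set `T`. It serves only to express connectedness, for which loops and multiplicities of edges
are immaterial. -/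
def adjGraph (T : Set G.E) : SimpleGraph G.V :=
  SimpleGraph.fromRel fun u v => ∃ e ∈ T, G.init e = u ∧ G.term e = v

/-- Connectedness (ignoring the directions of the edges); in particular there is a vertex. -/
def IsConnected : Prop := (G.adjGraph Set.univ).Connected

/-- The edge `e` is a loop. -/
def IsLoop (e : G.E) : Prop := G.init e = G.term e

/-- `v` is a cut vertex: the subgraph induced on the remaining vertices is disconnected. -/
def IsCutVertex (v : G.V) : Prop := ¬ ((G.adjGraph Set.univ).induce {v}ᶜ).Preconnected

/-- The edge set `T` contains the edges of a simple closed curve: there are `k + 1` distinct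
vertices in cyclic order (indices are taken modulo `k + 1`), joined cyclically by `k + 1` distinct
edges of `T`, whose directions do not matter. For `k = 0` it is a loop, for `k = 1` a pair of
distinct edges with the same two endpoints. -/
def HasSimpleClosedCurve (T : Set G.E) : Prop :=
  ∃ (k : ℕ) (x : Fin (k + 1) → G.V) (c : Fin (k + 1) → G.E),
    Function.Injective x ∧ Function.Injective c ∧ (∀ i, c i ∈ T) ∧
    ∀ i, (G.init (c i) = x i ∧ G.term (c i) = x (i + 1)) ∨
      (G.term (c i) = x i ∧ G.init (c i) = x (i + 1))

/-- `T` is the edge set of a directed spanning subtree of `G` with origin `v`: the subgraph with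
all the vertices of `G` and edge set `T` is connected, contains no simple closed curve, every
vertex is the terminal vertex of at most one edge of `T`, and `v` is the terminal vertex of no edge
of `T`. -/
structure IsDirectedSpanningTree (v : G.V) (T : Set G.E) : Prop where
  connected : (G.adjGraph T).Connected
  acyclic : ¬ G.HasSimpleClosedCurve T
  atMostOne : ∀ e ∈ T, ∀ f ∈ T, G.term e = G.term f → e = f
  origin : ∀ e ∈ T, G.term e ≠ v

/-- The set of directed spanning subtrees of `G` with origin `v`. A spanning subtree is
determined by its set of edges. -/
def spanningTrees (v : G.V) : Set (Set G.E) := {T | G.IsDirectedSpanningTree v T}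

/-- A dart is an edge together with a direction in which it is traversed: `(e, true)` runs from the
initial to the terminal endpoint of `e`, and `(e, false)` runs backwards. Equivalently a dart is an
end of an edge at the vertex where the dart starts. -/
abbrev Dart : Type u := G.E × Bool

/-- The vertex at which a dart starts. -/
def src (d : G.Dart) : G.V := if d.2 then G.init d.1 else G.term d.1

/-- The vertex at which a dart ends. -/
def tgt (d : G.Dart) : G.V := if d.2 then G.term d.1 else G.init d.1

/-- The same edge, traversed in the opposite direction. -/
def flip : Equiv.Perm G.Dart where
  toFun d := (d.1, !d.2)
  invFun d := (d.1, !d.2)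
  left_inv d := by simp
  right_inv d := by simp

end FinDigraph

/-- A finite digraph with a cellular embedding into an oriented closed surface, given by its
rotation system: `rot` sends a dart to the next dart, counterclockwise, among those that start at
the same vertex, and its cycles are exactly the sets of darts starting at a given vertex. For a
connected digraph these data are the same as the embedding up to orientation-preserving
homeomorphism. -/
structure EmbeddedDigraph extends FinDigraph.{u} where
  rot : Equiv.Perm toFinDigraph.Dart
  rot_sameCycle : ∀ d d' : toFinDigraph.Dart,
    rot.SameCycle d d' ↔ toFinDigraph.src d = toFinDigraph.src d'

namespace EmbeddedDigraph

variable (G : EmbeddedDigraph.{u})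

/-- The permutation of the darts that follows the boundary of the region on the left of a dart:
after `d`, the boundary continues along the dart that precedes the reverse of `d` in the
counterclockwise order at the end of `d`. -/
def facePerm : Equiv.Perm G.Dart := G.rot⁻¹ * G.flip

/-- The boundary components of the regions: the cycles of `facePerm`. For a connected digraph with
at least one edge these correspond to the regions of the complement. -/
def Face : Type u := Quotient (Equiv.Perm.SameCycle.setoid G.facePerm)

/-- The region on the left of a dart. -/
def left (d : G.Dart) : G.Face := Quotient.mk _ d

/-- The region on the right of a dart. -/
def right (d : G.Dart) : G.Face := G.left (G.flip d)

/-- The number of regions of the complement of a connected digraph. A connected digraph without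
edges is a point, whose complement is one region; `Face` is empty only in this case. -/
noncomputable def numRegions : ℕ := max 1 (Nat.card G.Face)

/-- The surface into which the (connected) digraph `G` is embedded is the sphere: its Euler
characteristic, vertices minus edges plus regions, is `2`. -/
def IsPlanar : Prop := Nat.card G.V + G.numRegions = Nat.card G.E + 2

/-- There is a simple closed curve in the sphere, disjoint from the vertices, that meets the edges
at exactly two points, where it crosses them, with at least one vertex on each side.
Here `S` is the set of the vertices on the left side of the curve, and `d₁`, `d₂` are the edges that
it crosses, directed from its left to its right side, so that these are the edges by which one
leaves `S`. The curve crosses `d₁` from the region on the right of `d₁` to the one on the left,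
inside which it runs on to `d₂`; it crosses `d₂` likewise and returns to its start. (If incoming and
outgoing edges alternate at every vertex there are no bridges, so that any curve which meets the
edges in exactly two points and separates two vertices crosses two distinct edges.) -/
def HasSeparatingTwoCurve : Prop :=
  ∃ (S : Set G.V) (d₁ d₂ : G.Dart), S.Nonempty ∧ Sᶜ.Nonempty ∧ d₁ ≠ d₂ ∧
    (∀ d : G.Dart, (G.src d ∈ S ∧ G.tgt d ∉ S) ↔ (d = d₁ ∨ d = d₂)) ∧
    G.left d₁ = G.right d₂ ∧ G.left d₂ = G.right d₁

/-- `G` is prime: it has no loop, no cut vertex, and there is no simple closed curve that is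
disjoint from the vertices, meets the edges at exactly two points, and has a vertex on each
side. -/
structure IsPrime : Prop where
  noLoop : ∀ e : G.E, ¬ G.IsLoop e
  noCutVertex : ∀ v : G.V, ¬ G.IsCutVertex v
  noCurve : ¬ G.HasSeparatingTwoCurve

/-- At every vertex, incoming and outgoing edges alternate: the dart that follows an end of an
outgoing edge is an end of an incoming edge, and vice versa. -/
def Alternates : Prop := ∀ d : G.Dart, (G.rot d).2 = !d.2

/-- The class `Γ` of connected, planar, prime digraphs such that incoming and outgoing edges
alternate at every vertex. -/
structure InGamma : Prop where
  connected : G.IsConnected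
  planar : G.IsPlanar
  prime : G.IsPrime
  alternates : G.Alternates

/-- An isomorphism of embedded digraphs: bijections of the vertices and of the edges that preserve
initial and terminal endpoints and the counterclockwise order at every vertex. -/
structure Iso (G H : EmbeddedDigraph.{u}) where
  onV : G.V ≃ H.V
  onE : G.E ≃ H.E
  map_init : ∀ e, onV (G.init e) = H.init (onE e)
  map_term : ∀ e, onV (G.term e) = H.term (onE e)
  map_rot : ∀ d : G.Dart, Prod.map onE id (G.rot d) = H.rot (Prod.map onE id d)

/-- Embedded digraphs are identified when they are isomorphic. -/
instance isoSetoid : Setoid EmbeddedDigraph.{u} where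
  r G H := Nonempty (Iso G H)
  iseqv :=
    { refl := fun _ => ⟨⟨Equiv.refl _, Equiv.refl _, fun _ => rfl, fun _ => rfl, fun _ => rfl⟩⟩
      symm := by
        rintro G H ⟨f⟩
        refine ⟨⟨f.onV.symm, f.onE.symm, fun e => ?_, fun e => ?_, fun d => ?_⟩⟩
        · rw [Equiv.symm_apply_eq, f.map_init, Equiv.apply_symm_apply]
        · rw [Equiv.symm_apply_eq, f.map_term, Equiv.apply_symm_apply]
        · have h := f.map_rot (Prod.map f.onE.symm id d)
          have h1 : Prod.map f.onE id (Prod.map f.onE.symm id d) = d := by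
            ext <;> simp
          rw [h1] at h
          rw [← h]
          ext <;> simp
      trans := by
        rintro G H K ⟨f⟩ ⟨g⟩
        refine ⟨⟨f.onV.trans g.onV, f.onE.trans g.onE, fun e => ?_, fun e => ?_, fun d => ?_⟩⟩
        · simp [f.map_init, g.map_init]
        · simp [f.map_term, g.map_term]
        · have h := g.map_rot (Prod.map f.onE id d)
          rw [← f.map_rot] at h
          exact h }

/-- The set of the members of `Γ`, up to isomorphism, that have some vertex with at most `n`
directed spanning subtrees with origin at that vertex. -/
def Phi (n : ℕ) : Set (Quotient isoSetoid.{u}) :=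
  {c | ∃ G : EmbeddedDigraph.{u}, Quotient.mk _ G = c ∧ G.InGamma ∧
    ∃ v : G.V, (G.spanningTrees v).ncard ≤ n}

end EmbeddedDigraph

/-!
The number of directed spanning trees with a given origin `r` bounds the numbers of vertices and of
edges, and there are only finitely many embedded digraphs of bounded size. Neither planarity nor
the absence of cut vertices is needed.

Alternation makes the digraph balanced: as many edges leave a set `S` of vertices as enter it
(`ncard_leaving_eq_ncard_entering`). It also makes the boundary of every region a directed closed
walk, so that if only one edge entered `S`, then the regions on both sides of it would be the ones on
both sides of the only edge leaving `S`, and a curve through these two regions would separate `S`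
from its complement. Hence every proper nonempty set of vertices is entered by at least two edges
(`exists_entering_ne`).

*Vertices.* By the case `k = 2` of Edmonds' theorem on disjoint arborescences, there are two
spanning trees `T` and `T₀` with origin `r` that have no edge in common
(`exists_parentMap_reaches_compl`). Number the vertices so that numbers increase along the edges
of `T`. For every `u`, let the vertices up to `u` choose the edge by which they are entered from `T`,
and the later ones from `T₀`. The result is again a spanning tree with origin `r`, and different `u`
give different trees. So there are at least as many trees as vertices (`card_V_le_ncard`).

*Edges.* Fix a spanning tree `T` with origin `r`. An edge `e` whose initial endpoint is not a
descendant of its terminal endpoint `v` can be exchanged for the edge of `T` that enters `v`, and `e`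
can be recovered from `v` and the new tree; this bounds the number of such edges
(`ncard_nonBack_le`). Every other edge leaves the set of descendants of some vertex `z ≠ r`. As
many edges leave this set as enter it, and the latter are all of the first kind (`card_E_le`).
-/

/-! ### Parent maps and directed spanning trees -/

namespace FinDigraph

variable (G : FinDigraph.{u})

instance : Finite G.V := G.finV

instance : Finite G.E := G.finE

/-- `p` chooses, for every vertex other than `r`, an edge that ends there, and `ρ` increases along
the chosen edges, so that they contain no directed cycle. The value `p r` is irrelevant. -/
def IsParentMap (r : G.V) (p : G.V → G.E) (ρ : G.V → ℕ) : Prop :=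
  ∀ v, v ≠ r → G.term (p v) = v ∧ ρ (G.init (p v)) < ρ v

/-- The set of the edges chosen by `p` at the vertices other than `r`. -/
def treeOf (r : G.V) (p : G.V → G.E) : Set G.E := p '' {r}ᶜ

variable {G} {r : G.V} {p q : G.V → G.E} {ρ : G.V → ℕ}

lemma exists_forall_rank_lt (ρ : G.V → ℕ) : ∃ M, ∀ v, ρ v < M := by
  obtain ⟨m, hm⟩ := (Set.finite_range ρ).bddAbove
  exact ⟨m + 1, fun v => Nat.lt_succ_of_le (hm ⟨v, rfl⟩)⟩

lemma IsParentMap.induction (h : G.IsParentMap r p ρ) {P : G.V → Prop} (root : P r)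
    (step : ∀ v, v ≠ r → P (G.init (p v)) → P v) (v : G.V) : P v := by
  induction hn : ρ v using Nat.strong_induction_on generalizing v with
  | _ n ih =>
    by_cases hv : v = r
    · rw [hv]
      exact root
    · exact step v hv (ih _ (hn ▸ (h v hv).2) _ rfl)

lemma IsParentMap.mem_spanningTrees (h : G.IsParentMap r p ρ) :
    G.treeOf r p ∈ G.spanningTrees r := by
  have term_p : ∀ v, v ≠ r → G.term (p v) = v := fun v hv => (h v hv).1
  refine ⟨?_, ?_, ?_, ?_⟩
  · refine (SimpleGraph.connected_iff_exists_forall_reachable _).2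
      ⟨r, h.induction (SimpleGraph.Reachable.refl r) fun v hv ih => ?_⟩
    obtain ⟨h1, h2⟩ := h v hv
    refine ih.trans (SimpleGraph.Adj.reachable ((SimpleGraph.fromRel_adj _ _ _).2
      ⟨?_, Or.inl ⟨p v, ⟨v, hv, rfl⟩, rfl, h1⟩⟩))
    intro h3
    rw [h3] at h2
    exact lt_irrefl _ h2
  · -- At a vertex of the curve with the largest rank, both edges of the curve come in.
    rintro ⟨k, x, c, hx, hc, hT, hends⟩
    have rank : ∀ e ∈ G.treeOf r p, ρ (G.init e) < ρ (G.term e) := by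
      rintro _ ⟨v, hv, rfl⟩
      rw [(h v hv).1]
      exact (h v hv).2
    obtain ⟨i, hi⟩ := Finite.exists_max fun i => ρ (x i)
    have h1 : G.term (c i) = x i := by
      rcases hends i with h0 | h0
      · have := rank _ (hT i)
        rw [h0.1, h0.2] at this
        exact absurd (hi (i + 1)) (not_le.2 this)
      · exact h0.1
    have h2 : G.term (c (i - 1)) = x i := by
      rcases hends (i - 1) with h0 | h0
      · simpa using h0.2
      · have := rank _ (hT (i - 1))
        rw [h0.1, h0.2] at this
        simp only [sub_add_cancel] at this
        exact absurd (hi (i - 1)) (not_le.2 this)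
    have h3 : c i = c (i - 1) := by
      obtain ⟨v, hv, hv'⟩ := hT i
      obtain ⟨w, hw, hw'⟩ := hT (i - 1)
      rw [← hv', term_p v hv] at h1
      rw [← hw', term_p w hw] at h2
      rw [← hv', ← hw', h1, h2]
    have h4 : i = i - 1 := hc h3
    have h5 : i + 1 = i := by
      have := congrArg (· + 1) h4
      simpa using this
    have h6 := rank _ (hT i)
    rcases hends i with h0 | h0 <;> rw [h0.1, h0.2, h5] at h6 <;> exact lt_irrefl _ h6
  · rintro _ ⟨v, hv, rfl⟩ _ ⟨w, hw, rfl⟩ hvw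
    rw [term_p v hv, term_p w hw] at hvw
    rw [hvw]
  · rintro _ ⟨v, hv, rfl⟩
    rw [term_p v hv]
    exact hv

lemma eq_of_treeOf_eq (hp : ∀ v, v ≠ r → G.term (p v) = v) (hq : ∀ v, v ≠ r → G.term (q v) = v)
    (h : G.treeOf r p = G.treeOf r q) {v : G.V} (hv : v ≠ r) : p v = q v := by
  have h1 : p v ∈ G.treeOf r q := h ▸ ⟨v, hv, rfl⟩
  obtain ⟨w, hw, hwv⟩ := h1
  have h2 : w = v := by rw [← hq w hw, hwv, hp v hv]
  rw [← hwv, h2]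

/-! ### Reachability along directed paths -/

/-- There is a directed path from `r` to `v` with edges in `H`. -/
def Reaches (G : FinDigraph.{u}) (H : Set G.E) (r v : G.V) : Prop :=
  Relation.ReflTransGen (fun u w => ∃ e ∈ H, G.init e = u ∧ G.term e = w) r v

lemma Reaches.mono {H K : Set G.E} (hHK : H ⊆ K) {v : G.V} (h : G.Reaches H r v) :
    G.Reaches K r v :=
  Relation.ReflTransGen.mono (fun _ _ ⟨e, he, h⟩ => ⟨e, hHK he, h⟩) _ _ h

lemma Reaches.step {H : Set G.E} {e : G.E} (he : e ∈ H) (h : G.Reaches H r (G.init e)) :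
    G.Reaches H r (G.term e) :=
  Relation.ReflTransGen.tail h ⟨e, he, rfl, rfl⟩

/-- A set that contains `r` and that no edge of `H` leaves contains everything reachable. -/
lemma Reaches.mem {H : Set G.E} {R : Set G.V} (hr : r ∈ R)
    (hR : ∀ e ∈ H, G.init e ∈ R → G.term e ∈ R) {v : G.V} (h : G.Reaches H r v) : v ∈ R := by
  induction h with
  | refl => exact hr
  | tail _ h ih =>
    obtain ⟨e, he, rfl, rfl⟩ := h
    exact hR e he ih

/-- There is a directed walk of length `n` from `r` to the given vertex, with edges in `H`. -/
def WalkOfLength (G : FinDigraph.{u}) (H : Set G.E) (r : G.V) : ℕ → G.V → Prop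
  | 0, v => v = r
  | n + 1, v => ∃ e ∈ H, WalkOfLength G H r n (G.init e) ∧ G.term e = v

/-- Breadth-first search: ranks are distances from `r`. -/
lemma exists_parentMap_of_reaches [Nonempty G.E] {H : Set G.E} (h : ∀ v, G.Reaches H r v) :
    ∃ p ρ, G.IsParentMap r p ρ ∧ ∀ v, v ≠ r → p v ∈ H := by
  classical
  have hw : ∀ v, ∃ n, G.WalkOfLength H r n v := by
    intro v
    refine Reaches.mem (R := {v | ∃ n, G.WalkOfLength H r n v}) ⟨0, rfl⟩ ?_ (h v)
    rintro e he ⟨n, hn⟩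
    exact ⟨n + 1, e, he, hn, rfl⟩
  have key : ∀ v, v ≠ r → ∃ e ∈ H, G.term e = v ∧ Nat.find (hw (G.init e)) < Nat.find (hw v) := by
    intro v hv
    have h1 := Nat.find_spec (hw v)
    rcases hn : Nat.find (hw v) with _ | m
    · rw [hn] at h1
      exact absurd h1 hv
    · rw [hn] at h1
      obtain ⟨e, he, h2, h3⟩ := h1
      exact ⟨e, he, h3, Nat.lt_succ_of_le (Nat.find_min' _ h2)⟩
  choose! p hp using key
  exact ⟨p, fun v => Nat.find (hw v), fun v hv => (hp v hv).2, fun v hv => (hp v hv).1⟩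

/-! ### Two disjoint spanning trees -/

/-- Lovász's exchange argument: if `H` misses only edges that end in `A`, every vertex is reachable
from `r ∈ A` in `H`, and every set that avoids `r` is entered by at least two edges, then some edge
that leaves `A` can be deleted from `H` so that every vertex remains reachable. -/
lemma exists_leaving_reaches_diff [Nonempty G.E]
    (h2 : ∀ S : Set G.V, S.Nonempty → r ∉ S → ∀ e, ∃ f, f ≠ e ∧ G.init f ∉ S ∧ G.term f ∈ S)
    {A : Set G.V} (hrA : r ∈ A) (hA : A ≠ Set.univ) {H : Set G.E}
    (hH : ∀ e, G.term e ∉ A → e ∈ H) (hreach : ∀ v, G.Reaches H r v) :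
    ∃ e, G.init e ∈ A ∧ G.term e ∉ A ∧ ∀ v, G.Reaches (H \ {e}) r v := by
  obtain ⟨e₀, -, h0⟩ := h2 Aᶜ (Set.nonempty_compl.2 hA) (fun h => h hrA) (Classical.arbitrary _)
  rw [Set.mem_compl_iff, not_not, Set.mem_compl_iff] at h0
  -- Take an edge after whose deletion as much as possible remains reachable.
  obtain ⟨e, ⟨he1, he2⟩, hmax⟩ := Set.Finite.exists_maximalFor
    (fun e => {v | G.Reaches (H \ {e}) r v}) {e | G.init e ∈ A ∧ G.term e ∉ A}
    (Set.toFinite _) ⟨e₀, h0⟩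
  refine ⟨e, he1, he2, ?_⟩
  by_contra hne
  have hterm : ¬ G.Reaches (H \ {e}) r (G.term e) := by
    intro ht
    refine hne fun v => Reaches.mem (R := {v | G.Reaches (H \ {e}) r v}) .refl ?_ (hreach v)
    intro f hf hfi
    by_cases hfe : f = e
    · rw [hfe]
      exact ht
    · exact Reaches.step ⟨hf, hfe⟩ hfi
  -- A second edge `f` into the unreachable vertices outside `A` starts in `A`, at a vertex that
  -- is unreachable without `e` but reachable without `f`.
  obtain ⟨f, hfe, hf1, hf2⟩ := h2 ({v | G.Reaches (H \ {e}) r v}ᶜ \ A) ⟨G.term e, hterm, he2⟩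
    (fun h => h.2 hrA) e
  have hfH : f ∈ H := hH f hf2.2
  have hfi : ¬ G.Reaches (H \ {e}) r (G.init f) := fun h => hf2.1 (Reaches.step ⟨hfH, hfe⟩ h)
  have hfA : G.init f ∈ A := by
    by_contra h
    exact hf1 ⟨hfi, h⟩
  have hsub : {v | G.Reaches (H \ {e}) r v} ⊆ {v | G.Reaches (H \ {f}) r v} := by
    intro v hv
    have := Reaches.mem (R := {v | G.Reaches (H \ {e}) r v ∧ G.Reaches (H \ {f}) r v})
      ⟨.refl, .refl⟩ ?_ hv
    · exact this.2
    · rintro g hg ⟨hg1, hg2⟩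
      have hgf : g ≠ f := by
        rintro rfl
        exact hfi hg1
      exact ⟨Reaches.step hg hg1, Reaches.step ⟨hg.1, hgf⟩ hg2⟩
  refine hfi (hmax (j := f) ⟨hfA, hf2.2⟩ hsub ?_)
  by_contra hnot
  refine hnot (Reaches.mem (R := {v | G.Reaches (H \ {f}) r v}) .refl ?_ (hreach (G.init f)))
  intro g hg hgi
  have hgf : g ≠ f := by
    rintro rfl
    exact hnot hgi
  exact Reaches.step ⟨hg, hgf⟩ hgi

/-- The case `k = 2` of Edmonds' theorem: if every set of vertices that avoids `r` is entered by at
least two edges, there is a spanning tree with origin `r` after whose deletion every vertex is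
still reachable from `r`. The ranks number the vertices in the order in which the tree grows. -/
lemma exists_parentMap_reaches_compl [Nonempty G.E]
    (h2 : ∀ S : Set G.V, S.Nonempty → r ∉ S → ∀ e, ∃ f, f ≠ e ∧ G.init f ∉ S ∧ G.term f ∈ S) :
    ∃ p ρ, G.IsParentMap r p ρ ∧ Function.Injective ρ ∧ ∀ v, G.Reaches (G.treeOf r p)ᶜ r v := by
  classical
  -- The vertex sets of partial trees, with the rank and reachability properties required in the end
  let good : Set (Set G.V) := {A | r ∈ A ∧ ∃ (p : G.V → G.E) (ρ : G.V → ℕ),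
    (∀ v ∈ A, v ≠ r → G.term (p v) = v ∧ G.init (p v) ∈ A ∧ ρ (G.init (p v)) < ρ v) ∧
    Set.InjOn ρ A ∧ ∀ v, G.Reaches (p '' (A \ {r}))ᶜ r v}
  have hgood : {r} ∈ good := by
    refine ⟨rfl, fun _ => Classical.arbitrary _, fun _ => 0, fun v hv hvr => absurd hv hvr,
      Set.injOn_singleton _ _, fun v => ?_⟩
    rw [Set.sdiff_self, Set.image_empty, Set.compl_empty]
    by_contra hv
    obtain ⟨f, -, hf1, hf2⟩ := h2 {v | ¬ G.Reaches Set.univ r v} ⟨v, hv⟩ (fun h => h .refl)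
      (Classical.arbitrary _)
    exact hf2 (Reaches.step trivial (not_not.1 hf1))
  obtain ⟨A, ⟨hrA, p, ρ, hp, hρ, hreach⟩, hmax⟩ :=
    Set.Finite.exists_maximal (Set.toFinite good) ⟨_, hgood⟩
  by_cases hA : A = Set.univ
  · subst hA
    refine ⟨p, ρ, fun v hv => ⟨(hp v trivial hv).1, (hp v trivial hv).2.2⟩,
      Set.injOn_univ.1 hρ, fun v => ?_⟩
    have := hreach v
    rwa [← Set.compl_eq_univ_sdiff] at this
  exfalso
  obtain ⟨e, he1, he2, he⟩ := exists_leaving_reaches_diff h2 hrA hA (H := (p '' (A \ {r}))ᶜ)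
    (by
      rintro _ hnot ⟨v, ⟨hv, hvr⟩, rfl⟩
      rw [(hp v hv hvr).1] at hnot
      exact hnot hv) hreach
  obtain ⟨M, hM⟩ := exists_forall_rank_lt ρ
  have hne : ∀ v ∈ A, v ≠ G.term e := by
    rintro v hv rfl
    exact he2 hv
  refine he2 (hmax (y := insert (G.term e) A) ⟨Or.inr hrA, Function.update p (G.term e) e,
    Function.update ρ (G.term e) M, ?_, ?_, ?_⟩ (Set.subset_insert _ _) (Set.mem_insert _ _))
  · rintro v (rfl | hv) hvr
    · rw [Function.update_self, Function.update_self, Function.update_of_ne (hne _ he1)]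
      exact ⟨rfl, Or.inr he1, hM _⟩
    · obtain ⟨h3, h4, h5⟩ := hp v hv hvr
      rw [Function.update_of_ne (hne v hv), Function.update_of_ne (hne v hv),
        Function.update_of_ne (hne _ h4)]
      exact ⟨h3, Or.inr h4, h5⟩
  · rintro v (rfl | hv) w (rfl | hw) hvw
    · rfl
    · rw [Function.update_self, Function.update_of_ne (hne w hw)] at hvw
      exact absurd hvw (hM w).ne'
    · rw [Function.update_self, Function.update_of_ne (hne v hv)] at hvw
      exact absurd hvw (hM v).ne
    · rw [Function.update_of_ne (hne v hv), Function.update_of_ne (hne w hw)] at hvw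
      exact hρ hv hw hvw
  · intro v
    refine (he v).mono ?_
    rintro f ⟨hf, hfe⟩ ⟨w, ⟨rfl | hw, hwr⟩, hwf⟩
    · rw [Function.update_self] at hwf
      exact hfe hwf.symm
    · rw [Function.update_of_ne (hne w hw)] at hwf
      exact hf ⟨w, ⟨hw, hwr⟩, hwf⟩

/-- There are at least as many spanning trees with origin `r` as vertices: of two disjoint ones, the
first can be used up to any vertex, and the second beyond it. -/
lemma card_V_le_ncard [Nonempty G.E]
    (h2 : ∀ S : Set G.V, S.Nonempty → r ∉ S → ∀ e, ∃ f, f ≠ e ∧ G.init f ∉ S ∧ G.term f ∈ S) :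
    Nat.card G.V ≤ (G.spanningTrees r).ncard := by
  classical
  obtain ⟨p, ρ, hp, hρ, hreach⟩ := exists_parentMap_reaches_compl h2
  obtain ⟨q, σ, hq, hqH⟩ := exists_parentMap_of_reaches hreach
  obtain ⟨M, hM⟩ := exists_forall_rank_lt ρ
  let mix : G.V → G.V → G.E := fun u v => if ρ v ≤ ρ u then p v else q v
  have hmix : ∀ u, G.IsParentMap r (mix u) fun v => if ρ v ≤ ρ u then ρ v else M + σ v := by
    intro u v hv
    have hpv := hp v hv
    have hqv := hq v hv
    by_cases h : ρ v ≤ ρ u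
    · simp only [mix, if_pos h, if_pos (hpv.2.le.trans h)]
      exact hpv
    · simp only [mix, if_neg h]
      refine ⟨hqv.1, ?_⟩
      split_ifs
      · exact (hM _).trans_le (Nat.le_add_right _ _)
      · exact Nat.add_lt_add_left hqv.2 M
  have hr : ∀ v, ρ r ≤ ρ v := hp.induction le_rfl fun v hv ih => ih.trans (hp v hv).2.le
  -- For `ρ u < ρ w`, the tree of `u` enters `w` by an edge outside the first tree.
  have hlt : ∀ u w, ρ u < ρ w → G.treeOf r (mix u) ≠ G.treeOf r (mix w) := by
    intro u w huw heq
    have hwr : w ≠ r := by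
      rintro rfl
      exact (hr u).not_gt huw
    have h := eq_of_treeOf_eq (fun v hv => (hmix u v hv).1) (fun v hv => (hmix w v hv).1) heq hwr
    simp only [mix, if_neg huw.not_ge, le_refl, if_true] at h
    exact hqH w hwr (h ▸ ⟨w, hwr, rfl⟩)
  have hinj : Function.Injective fun u => G.treeOf r (mix u) := by
    intro u w h
    rcases lt_trichotomy (ρ u) (ρ w) with h1 | h1 | h1
    · exact absurd h (hlt u w h1)
    · exact hρ h1
    · exact absurd h.symm (hlt w u h1)
  rw [← Set.ncard_univ]
  exact Set.ncard_le_ncard_of_injOn _ (fun u _ => (hmix u).mem_spanningTrees) hinj.injOn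
    (Set.toFinite _)

/-! ### Balanced digraphs and the number of edges -/

lemma ncard_leaving_eq_ncard_entering (σ : Equiv.Perm G.E) (hσ : ∀ e, G.term (σ e) = G.init e)
    (S : Set G.V) : {e | G.init e ∈ S ∧ G.term e ∉ S}.ncard =
      {e | G.init e ∉ S ∧ G.term e ∈ S}.ncard := by
  have h1 : {e | G.init e ∈ S}.ncard = {e | G.term e ∈ S}.ncard := by
    rw [← Set.ncard_image_of_injective _ σ.injective]
    congr 1
    ext e
    constructor
    · rintro ⟨f, hf, rfl⟩
      simpa [hσ] using hf
    · intro he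
      refine ⟨σ.symm e, ?_, σ.apply_symm_apply e⟩
      rw [Set.mem_ofPred_eq, ← hσ, σ.apply_symm_apply]
      exact he
  have h2 := Set.ncard_inter_add_ncard_sdiff_eq_ncard {e | G.init e ∈ S} {e | G.term e ∈ S}
  have h3 := Set.ncard_inter_add_ncard_sdiff_eq_ncard {e | G.term e ∈ S} {e | G.init e ∈ S}
  rw [Set.inter_comm] at h3
  have h4 : {e | G.init e ∈ S ∧ G.term e ∉ S} = {e | G.init e ∈ S} \ {e | G.term e ∈ S} := rfl
  have h5 : {e | G.init e ∉ S ∧ G.term e ∈ S} = {e | G.term e ∈ S} \ {e | G.init e ∈ S} := by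
    ext e
    exact and_comm
  rw [h4, h5]
  omega

/-- The vertices whose path from `r` in the tree of `p` passes through `v`, including `v`. -/
def descendants (G : FinDigraph.{u}) (r : G.V) (p : G.V → G.E) (v : G.V) : Set G.V :=
  {x | Relation.ReflTransGen (fun a b => b ≠ r ∧ a = G.init (p b)) v x}

/-- The edges that can be exchanged into the tree of `p`: they do not end at `r`, and do not start at
a descendant of their terminal endpoint. The edges of the tree are among them. -/
def nonBack (G : FinDigraph.{u}) (r : G.V) (p : G.V → G.E) : Set G.E :=
  {e | G.term e ≠ r ∧ G.init e ∉ G.descendants r p (G.term e)}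

lemma not_mem_descendants {z : G.V} (hz : z ≠ r) : r ∉ G.descendants r p z := by
  intro h
  rcases Relation.ReflTransGen.cases_tail h with h | ⟨_, -, h, -⟩
  · exact hz h.symm
  · exact h rfl

lemma IsParentMap.rank_le (h : G.IsParentMap r p ρ) {v x : G.V} (hx : x ∈ G.descendants r p v) :
    ρ v ≤ ρ x := by
  induction hx with
  | refl => exact le_rfl
  | tail _ h1 ih =>
    obtain ⟨hb, rfl⟩ := h1
    exact ih.trans (h _ hb).2.le

lemma IsParentMap.mem_descendants_root (h : G.IsParentMap r p ρ) (x : G.V) :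
    x ∈ G.descendants r p r :=
  h.induction (P := (· ∈ G.descendants r p r)) .refl (fun _ hv ih => ih.tail ⟨hv, rfl⟩) x

/-- An edge of `nonBack` can replace the edge of the tree with the same terminal endpoint, and is
determined by this endpoint and the new tree. -/
lemma IsParentMap.ncard_nonBack_le (h : G.IsParentMap r p ρ) :
    (G.nonBack r p).ncard ≤ Nat.card G.V * (G.spanningTrees r).ncard := by
  classical
  obtain ⟨M, hM⟩ := exists_forall_rank_lt ρ
  -- After the exchange at `v`, all descendants of `v` are ranked above everything else.
  have hex : ∀ e ∈ G.nonBack r p, G.IsParentMap r (Function.update p (G.term e) e)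
      fun x => if x ∈ G.descendants r p (G.term e) then M + ρ x else ρ x := by
    rintro e ⟨-, he2⟩ v hv
    beta_reduce
    by_cases hve : v = G.term e
    · subst hve
      have hself : G.term e ∈ G.descendants r p (G.term e) := .refl
      rw [Function.update_self, if_neg he2, if_pos hself]
      exact ⟨rfl, (hM _).trans_le (Nat.le_add_right _ _)⟩
    · rw [Function.update_of_ne hve]
      refine ⟨(h v hv).1, ?_⟩
      have h1 := (h v hv).2
      by_cases h2 : G.init (p v) ∈ G.descendants r p (G.term e)
      · have h3 : v ∈ G.descendants r p (G.term e) := h2.tail ⟨hv, rfl⟩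
        rw [if_pos h2, if_pos h3]
        exact Nat.add_lt_add_left h1 M
      · rw [if_neg h2]
        split_ifs
        · exact h1.trans_le (Nat.le_add_left _ _)
        · exact h1
  rw [← Set.ncard_univ, ← Set.ncard_prod]
  refine Set.ncard_le_ncard_of_injOn
    (fun e => (G.term e, G.treeOf r (Function.update p (G.term e) e)))
    (fun e he => ⟨trivial, (hex e he).mem_spanningTrees⟩) ?_ (Set.toFinite _)
  intro e he f hf hef
  simp only [Prod.mk.injEq] at hef
  have := eq_of_treeOf_eq (fun v hv => (hex e he v hv).1) (fun v hv => (hex f hf v hv).1)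
    hef.2 he.1
  rwa [Function.update_self, hef.1, Function.update_self] at this

lemma IsParentMap.card_E_le (h : G.IsParentMap r p ρ) (σ : Equiv.Perm G.E)
    (hσ : ∀ e, G.term (σ e) = G.init e) (hloop : ∀ e, ¬ G.IsLoop e) :
    Nat.card G.E ≤ (Nat.card G.V + 1) * (G.nonBack r p).ncard := by
  classical
  have := Fintype.ofFinite G.V
  let leaving : G.V → Set G.E := fun z =>
    {e | z ≠ r ∧ G.init e ∈ G.descendants r p z ∧ G.term e ∉ G.descendants r p z}
  have hleaving : ∀ z, (leaving z).ncard ≤ (G.nonBack r p).ncard := by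
    intro z
    by_cases hz : z = r
    · have : leaving z = ∅ := by
        ext e
        simp [leaving, hz]
      rw [this, Set.ncard_empty]
      exact Nat.zero_le _
    · have h1 : leaving z =
          {e | G.init e ∈ G.descendants r p z ∧ G.term e ∉ G.descendants r p z} := by
        ext e
        simp [leaving, hz]
      rw [h1, ncard_leaving_eq_ncard_entering σ hσ]
      refine Set.ncard_le_ncard ?_ (Set.toFinite _)
      rintro e ⟨he1, he2⟩
      refine ⟨?_, fun h3 => he1 (Relation.ReflTransGen.trans he2 h3)⟩
      intro h3
      rw [h3] at he2
      exact not_mem_descendants hz he2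
  have hcover : (Set.univ : Set G.E) ⊆ G.nonBack r p ∪ ⋃ z ∈ Finset.univ, leaving z := by
    intro e _
    by_cases he : e ∈ G.nonBack r p
    · exact Or.inl he
    right
    have h1 : G.init e ∈ G.descendants r p (G.term e) := by
      by_contra h1
      refine he ⟨fun h2 => h1 ?_, h1⟩
      rw [h2]
      exact h.mem_descendants_root _
    -- The edge leaves the descendants of the child `z` of its terminal endpoint.
    rcases Relation.ReflTransGen.cases_head h1 with h2 | ⟨z, ⟨hz, hz'⟩, h2⟩
    · exact absurd h2.symm (hloop e)
    · refine Set.mem_biUnion (Finset.mem_coe.2 (Finset.mem_univ z)) ⟨hz, h2, fun h3 => ?_⟩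
      have h4 := h.rank_le h3
      rw [hz'] at h4
      exact h4.not_gt (h z hz).2
  calc Nat.card G.E = (Set.univ : Set G.E).ncard := (Set.ncard_univ _).symm
    _ ≤ (G.nonBack r p ∪ ⋃ z ∈ Finset.univ, leaving z).ncard :=
        Set.ncard_le_ncard hcover (Set.toFinite _)
    _ ≤ (G.nonBack r p).ncard + (⋃ z ∈ Finset.univ, leaving z).ncard := Set.ncard_union_le _ _
    _ ≤ (G.nonBack r p).ncard + ∑ z, (leaving z).ncard := by
        gcongr
        exact Finset.set_ncard_biUnion_le _ _
    _ ≤ (G.nonBack r p).ncard + ∑ _z : G.V, (G.nonBack r p).ncard := by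
        exact Nat.add_le_add_left (Finset.sum_le_sum fun z _ => hleaving z) _
    _ = (Nat.card G.V + 1) * (G.nonBack r p).ncard := by
        rw [Finset.sum_const, Finset.card_univ, smul_eq_mul, Nat.card_eq_fintype_card]
        ring

end FinDigraph

/-! ### Alternating embedded digraphs -/

namespace EmbeddedDigraph

variable {G : EmbeddedDigraph.{u}}

/-- Rotating an outgoing end yields an incoming end at the same vertex. -/
lemma Alternates.exists_perm (h : G.Alternates) :
    ∃ σ : Equiv.Perm G.E, ∀ e, G.term (σ e) = G.init e := by
  let s : G.E → G.E := fun e => (G.rot (e, true)).1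
  have hs : ∀ e, G.rot (e, true) = (s e, false) := fun e => Prod.ext rfl (h (e, true))
  have hinj : Function.Injective s := by
    intro e f hef
    have : G.rot (e, true) = G.rot (f, true) := by rw [hs, hs, hef]
    exact congrArg Prod.fst (G.rot.injective this)
  refine ⟨Equiv.ofBijective s (Finite.injective_iff_bijective.1 hinj), fun e => ?_⟩
  have h1 : G.rot.SameCycle (e, true) (G.rot (e, true)) :=
    Equiv.Perm.sameCycle_apply_right.2 (Equiv.Perm.SameCycle.refl _ _)
  have h2 := (G.rot_sameCycle _ _).1 h1
  rw [hs] at h2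
  exact h2.symm

lemma src_facePerm (d : G.Dart) : G.src (G.facePerm d) = G.tgt d := by
  have h1 : G.rot.SameCycle (G.rot⁻¹ (G.flip d)) (G.flip d) := ⟨1, by simp⟩
  have h2 := (G.rot_sameCycle _ _).1 h1
  rw [facePerm, Equiv.Perm.mul_apply, h2]
  rcases d with ⟨e, _ | _⟩ <;> rfl

lemma Alternates.facePerm_snd (h : G.Alternates) (d : G.Dart) : (G.facePerm d).2 = d.2 := by
  have h1 := h (G.rot⁻¹ (G.flip d))
  rw [← Equiv.Perm.mul_apply, mul_inv_cancel, Equiv.Perm.one_apply] at h1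
  have h2 : (G.flip d).2 = !d.2 := rfl
  rw [h2] at h1
  rw [facePerm, Equiv.Perm.mul_apply]
  exact (Bool.not_inj h1).symm

/-- The boundary of the region on the left of a dart that leaves `S` returns to `S`, and all its
edges are traversed in the same sense. -/
lemma Alternates.exists_left_eq (h : G.Alternates) {S : Set G.V} {d : G.Dart} (hd : G.src d ∈ S) :
    G.tgt d ∉ S → ∃ d', G.left d = G.left d' ∧ d'.2 = d.2 ∧ G.src d' ∉ S ∧ G.tgt d' ∈ S := by
  intro hd'
  by_contra hno
  push Not at hno
  have key : ∀ k, G.src ((G.facePerm ^ (k + 1)) d) ∉ S ∧ ((G.facePerm ^ (k + 1)) d).2 = d.2 := by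
    intro k
    induction k with
    | zero =>
      rw [zero_add, pow_one, src_facePerm, h.facePerm_snd]
      exact ⟨hd', rfl⟩
    | succ k ih =>
      rw [pow_succ', Equiv.Perm.mul_apply, src_facePerm, h.facePerm_snd]
      refine ⟨hno _ (Quotient.sound ?_) ih.2 ih.1, ih.2⟩
      exact Equiv.Perm.sameCycle_pow_right.2 (Equiv.Perm.SameCycle.refl _ _)
  obtain ⟨m, hm⟩ := Nat.exists_eq_succ_of_ne_zero (orderOf_pos G.facePerm).ne'
  have h1 := (key m).1
  rw [← Nat.succ_eq_add_one, ← hm, pow_orderOf_eq_one] at h1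
  exact h1 hd

/-- Every proper nonempty set of vertices is entered by at least two edges. -/
lemma InGamma.exists_entering_ne (h : G.InGamma) {S : Set G.V} (hS : S.Nonempty)
    (hS' : Sᶜ.Nonempty) (e : G.E) : ∃ f, f ≠ e ∧ G.init f ∉ S ∧ G.term f ∈ S := by
  obtain ⟨σ, hσ⟩ := h.alternates.exists_perm
  have hbal := FinDigraph.ncard_leaving_eq_ncard_entering σ hσ S
  by_contra hno
  push Not at hno
  have huniq : ∀ f, G.init f ∉ S → G.term f ∈ S → f = e := by
    intro f hf1 hf2
    by_contra hfe
    exact hno f hfe hf1 hf2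
  have hcross : (∃ f, G.init f ∈ S ∧ G.term f ∉ S) ∨ ∃ f, G.init f ∉ S ∧ G.term f ∈ S := by
    by_contra hc
    push Not at hc
    obtain ⟨a, ha⟩ := hS
    obtain ⟨b, hb⟩ := hS'
    obtain ⟨w⟩ := h.connected.preconnected a b
    refine hb ?_
    have : ∀ x y, (G.adjGraph Set.univ).Walk x y → x ∈ S → y ∈ S := by
      intro x y w
      induction w with
      | nil => exact id
      | cons hadj _ ih =>
        intro hx
        refine ih ?_
        obtain ⟨-, ⟨f, -, rfl, rfl⟩ | ⟨f, -, rfl, rfl⟩⟩ := (SimpleGraph.fromRel_adj _ _ _).1 hadj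
        · exact hc.1 f hx
        · by_contra hf
          exact hc.2 f hf hx
    exact this a b w ha
  have hin : {f | G.init f ∉ S ∧ G.term f ∈ S} = {e} := by
    have hsub : {f | G.init f ∉ S ∧ G.term f ∈ S} ⊆ {e} := fun f hf => huniq f hf.1 hf.2
    rcases Set.subset_singleton_iff_eq.1 hsub with h0 | h0
    · rw [h0, Set.ncard_empty, Set.ncard_eq_zero] at hbal
      rcases hcross with ⟨f, hf⟩ | ⟨f, hf⟩
      · exact absurd (hbal ▸ hf : f ∈ (∅ : Set G.E)) (Set.notMem_empty f)
      · exact absurd (h0 ▸ hf : f ∈ (∅ : Set G.E)) (Set.notMem_empty f)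
    · exact h0
  rw [hin, Set.ncard_singleton, Set.ncard_eq_one] at hbal
  obtain ⟨g, hout⟩ := hbal
  have hin' : ∀ f, (G.init f ∉ S ∧ G.term f ∈ S) ↔ f = e := fun f => Set.ext_iff.1 hin f
  have hout' : ∀ f, (G.init f ∈ S ∧ G.term f ∉ S) ↔ f = g := fun f => Set.ext_iff.1 hout f
  have hg := (hout' g).2 rfl
  have he := (hin' e).2 rfl
  refine h.prime.noCurve ⟨S, (g, true), (e, false), hS, hS', by simp, ?_, ?_, ?_⟩
  · rintro ⟨f, _ | _⟩
    · simpa [FinDigraph.src, FinDigraph.tgt, and_comm] using hin' f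
    · simpa [FinDigraph.src, FinDigraph.tgt] using hout' f
  · obtain ⟨⟨f, b⟩, h1, h2, h3, h4⟩ :=
      h.alternates.exists_left_eq (S := S) (d := (g, true)) hg.1 hg.2
    obtain rfl : b = true := h2
    obtain rfl : f = e := (hin' f).1 ⟨h3, h4⟩
    exact h1
  · obtain ⟨⟨f, b⟩, h1, h2, h3, h4⟩ :=
      h.alternates.exists_left_eq (S := S) (d := (e, false)) he.2 he.1
    obtain rfl : b = false := h2
    obtain rfl : f = g := (hout' f).1 ⟨h4, h3⟩
    exact h1

/-- The numbers of vertices and edges are bounded in terms of the number of spanning trees. The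
bound on the vertices is `n + 1` to include a single vertex without edges. -/
lemma InGamma.card_le (h : G.InGamma) {n : ℕ} {r : G.V} (hn : (G.spanningTrees r).ncard ≤ n) :
    Nat.card G.V ≤ n + 1 ∧ Nat.card G.E ≤ (n + 2) * ((n + 1) * n) := by
  rcases isEmpty_or_nonempty G.E with hE | hE
  · have : Subsingleton G.V := by
      refine ⟨fun a b => ?_⟩
      obtain ⟨w⟩ := h.connected.preconnected a b
      cases w with
      | nil => rfl
      | cons hadj _ =>
        obtain ⟨-, ⟨f, -⟩ | ⟨f, -⟩⟩ := (SimpleGraph.fromRel_adj _ _ _).1 hadj <;>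
          exact isEmptyElim f
    rw [Nat.card_of_isEmpty (α := G.E)]
    exact ⟨(Finite.card_le_one_iff_subsingleton.2 this).trans (Nat.le_add_left _ _),
      Nat.zero_le _⟩
  · have h2 : ∀ S : Set G.V, S.Nonempty → r ∉ S → ∀ e, ∃ f, f ≠ e ∧ G.init f ∉ S ∧ G.term f ∈ S :=
      fun S hS hr => h.exists_entering_ne hS ⟨r, hr⟩
    have hV : Nat.card G.V ≤ n + 1 :=
      (FinDigraph.card_V_le_ncard h2).trans (hn.trans (Nat.le_succ n))
    obtain ⟨p, ρ, hp, -⟩ := FinDigraph.exists_parentMap_reaches_compl h2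
    obtain ⟨σ, hσ⟩ := h.alternates.exists_perm
    refine ⟨hV, (hp.card_E_le σ hσ h.prime.noLoop).trans ?_⟩
    exact Nat.mul_le_mul (Nat.succ_le_succ hV) (hp.ncard_nonBack_le.trans (Nat.mul_le_mul hV hn))

/-! ### Embedded digraphs of bounded size -/

/-- Up to isomorphism, there are finitely many embedded digraphs with given numbers of vertices and
edges: with the vertices and edges numbered, the digraph is described by functions between finite
types. -/
lemma finite_setOf_card_eq (N M : ℕ) :
    {c : Quotient isoSetoid.{u} | ∃ G : EmbeddedDigraph.{u}, Quotient.mk _ G = c ∧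
      Nat.card G.V = N ∧ Nat.card G.E = M}.Finite := by
  have hrep : ∀ c ∈ {c : Quotient isoSetoid.{u} | ∃ G : EmbeddedDigraph.{u}, Quotient.mk _ G = c ∧
      Nat.card G.V = N ∧ Nat.card G.E = M}, ∃ D : (Fin M → Fin N) × (Fin M → Fin N) ×
        (Fin M × Bool → Fin M × Bool), ∃ (G : EmbeddedDigraph.{u}) (a : G.V ≃ Fin N)
        (b : G.E ≃ Fin M), Quotient.mk _ G = c ∧ (∀ e, a (G.init e) = D.1 (b e)) ∧
        (∀ e, a (G.term e) = D.2.1 (b e)) ∧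
        ∀ d : G.Dart, Prod.map b id (G.rot d) = D.2.2 (Prod.map b id d) := by
    rintro c ⟨G, hc, hN, hM⟩
    let a : G.V ≃ Fin N := Finite.equivFinOfCardEq hN
    let b : G.E ≃ Fin M := Finite.equivFinOfCardEq hM
    refine ⟨(fun i => a (G.init (b.symm i)), fun i => a (G.term (b.symm i)),
      fun d => Prod.map b id (G.rot (Prod.map b.symm id d))), G, a, b, hc, ?_, ?_, ?_⟩
    · intro e
      simp
    · intro e
      simp
    · rintro ⟨e, s⟩
      simp
  choose D hD using hrep
  refine Set.finite_coe_iff.1 (Finite.of_injective (fun c => D c.1 c.2) ?_)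
  rintro ⟨c, hc⟩ ⟨c', hc'⟩ heq
  beta_reduce at heq
  obtain ⟨G, a, b, rfl, h1, h2, h3⟩ := hD c hc
  obtain ⟨G', a', b', rfl, h1', h2', h3'⟩ := hD c' hc'
  rw [← heq] at h1' h2' h3'
  refine Subtype.ext (Quotient.sound ⟨⟨a.trans a'.symm, b.trans b'.symm, fun e => ?_, fun e => ?_, fun d => ?_⟩⟩)
  · rw [Equiv.trans_apply, Equiv.symm_apply_eq, h1, h1']
    simp
  · rw [Equiv.trans_apply, Equiv.symm_apply_eq, h2, h2']
    simp
  · have hinj : Function.Injective (Prod.map b' (id : Bool → Bool)) :=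
      b'.injective.prodMap Function.injective_id
    have hcomp : ∀ x : G.Dart,
        Prod.map b' id (Prod.map (b.trans b'.symm) id x) = Prod.map b (id : Bool → Bool) x := by
      rintro ⟨e, s⟩
      simp
    apply hinj
    rw [h3', hcomp, hcomp, h3]

end EmbeddedDigraph

theorem mainTheorem3 (n : ℕ) : (EmbeddedDigraph.Phi.{u} n).Finite := by
  refine Set.Finite.subset (Set.Finite.biUnion (Set.finite_Iic (n + 1)) fun N _ =>
    Set.Finite.biUnion (Set.finite_Iic ((n + 2) * ((n + 1) * n))) fun M _ =>
      EmbeddedDigraph.finite_setOf_card_eq N M) ?_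
  rintro c ⟨G, hc, hG, r, hr⟩
  obtain ⟨hV, hE⟩ := hG.card_le hr
  exact Set.mem_biUnion hV (Set.mem_biUnion hE ⟨G, hc, rfl, rfl⟩)
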